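/- Let $k$ be a field, let $n\ge 0$ be an integer, and let $$A_n = k\langle x_1,\dots,x_n \mid [[x_i,x_{i+2}],x_{i+1}],\ i=1,\dots,n-2\rangle$$ be the quotient of the free associative unital algebra on $x_1,\dots,x_n$ by the two-sided ideal generated by the listed elements (there are none if $n\le 2$), where $[a,b]=ab-ba$. Let $\mathbf A_n$ be the differential graded algebra over $k$ which, as a graded algebra, is the free associative unital algebra on generators $x_1,\dots,x_n$ of degree $0$ and $u_{1,2,3},\dots,u_{n-2,n-1,n}$ of degree $-1$, with the differential $d$ of degree $+1$ determined by the graded Leibniz rule $d(ab)=d(a)\,b+(-1)^{\deg a}a\,d(b)$ and $$d(x_i)=0,\qquad d(u_{i,i+1,i+2})=[[x_i,x_{i+2}],x_{i+1}].$$ Then $\mathbf A_n$ is a minimal free resolution of $A_n$. That is, it is free as a graded algebra on generators of non-positive degree; its differential sends every generator to a linear combination of products of at least two generators; and the algebra map $p:\mathbf A_n\to A_n$ with $p(x_i)=x_i$ and $p(u_{i,i+1,i+2})=0$ is a quasi-isomorphism of differential graded algebras, where $A_n$ is placed in degree $0$ with zero differential. In other words, $H^i(\mathbf A_n)=0$ for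 all $i\neq 0$, and $p$ induces an isomorphism $H^0(\mathbf A_n)\cong A_n$. -/

import Mathlib

/-- A (cohomologically graded) differential graded associative unital algebra over the field `k`,
with underlying algebra `R`: a `ℤ`-grading of the algebra `R` together with a differential of
degree `+1` that satisfies the graded Leibniz rule. -/
structure DGAlgebra (k : Type*) (R : Type*) [Field k] [Ring R] [Algebra k R] where
  /-- the homogeneous component of each degree -/
  piece : ℤ → Submodule k R
  one_mem : (1 : R) ∈ piece 0
  mul_mem : ∀ {i j : ℤ} {a b : R}, a ∈ piece i → b ∈ piece j → a * b ∈ piece (i + j)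
  internal : DirectSum.IsInternal piece
  /-- the differential -/
  d : R →ₗ[k] R
  d_mem : ∀ {i : ℤ} {a : R}, a ∈ piece i → d a ∈ piece (i + 1)
  d_d : ∀ a : R, d (d a) = 0
  leibniz : ∀ {i : ℤ} {a : R}, a ∈ piece i → ∀ b : R,
    d (a * b) = d a * b + (i.negOnePow : ℤ) • (a * d b)

namespace DGAlgebra

section Cohomology

variable {k R S : Type*} [Field k] [Ring R] [Algebra k R] [Ring S] [Algebra k S]

/-- The cocycles of degree `i`. -/
def cocycles (D : DGAlgebra k R) (i : ℤ) : Submodule k R :=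
  D.piece i ⊓ LinearMap.ker D.d

/-- The coboundaries of degree `i`. -/
def coboundaries (D : DGAlgebra k R) (i : ℤ) : Submodule k R :=
  (D.piece (i - 1)).map D.d

/-- The cohomology in degree `i`: cocycles modulo coboundaries. -/
abbrev Cohomology (D : DGAlgebra k R) (i : ℤ) : Type _ :=
  ↥(D.cocycles i) ⧸ (D.coboundaries i).submoduleOf (D.cocycles i)

/-- A morphism of differential graded algebras. -/
structure Hom (D : DGAlgebra k R) (E : DGAlgebra k S) extends R →ₐ[k] S where
  map_piece : ∀ {i : ℤ} {a : R}, a ∈ D.piece i → toAlgHom a ∈ E.piece i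
  map_d : ∀ a : R, toAlgHom (D.d a) = E.d (toAlgHom a)

/-- The action of a morphism of dg algebras on cocycles. -/
def Hom.mapCocycles {D : DGAlgebra k R} {E : DGAlgebra k S} (f : Hom D E) (i : ℤ) :
    ↥(D.cocycles i) →ₗ[k] ↥(E.cocycles i) :=
  f.toAlgHom.toLinearMap.restrict fun a ha =>
    ⟨f.map_piece ha.1, by
      have h : D.d a = 0 := ha.2
      change E.d (f.toAlgHom a) = 0
      rw [← f.map_d, h, map_zero]⟩

/-- The map induced on cohomology by a morphism of dg algebras. -/
def Hom.mapCohomology {D : DGAlgebra k R} {E : DGAlgebra k S} (f : Hom D E) (i : ℤ) :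
    D.Cohomology i →ₗ[k] E.Cohomology i :=
  Submodule.mapQ _ _ (f.mapCocycles i) (by
    rintro ⟨a, ha⟩ ⟨b, hb, rfl⟩
    exact ⟨f.toAlgHom b, f.map_piece hb, (f.map_d b).symm⟩)

/-- A quasi-isomorphism is a morphism inducing isomorphisms on all cohomology spaces. -/
def Hom.IsQuasiIso {D : DGAlgebra k R} {E : DGAlgebra k S} (f : Hom D E) : Prop :=
  ∀ i : ℤ, Function.Bijective (f.mapCohomology i)

/-- `D` is free, as a graded algebra, on the family of homogeneous elements `g x` of degree
`deg x`: the algebra map from the free algebra determined by `g` is an isomorphism. -/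
structure IsFreeOn (D : DGAlgebra k R) {X : Type*} (deg : X → ℤ) (g : X → R) : Prop where
  mem : ∀ x, g x ∈ D.piece (deg x)
  bijective : Function.Bijective (FreeAlgebra.lift k g)

variable (k S)

/-- The algebra `S` as a dg algebra concentrated in degree `0`, with zero differential. -/
def ofAlgebra : DGAlgebra k S where
  piece i := if i = 0 then ⊤ else ⊥
  one_mem := by simp
  mul_mem {i j a b} ha hb := by
    by_cases hi : i = 0 <;> by_cases hj : j = 0 <;> simp_all
  internal := by
    rw [DirectSum.isInternal_submodule_iff_iSupIndep_and_iSup_eq_top]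
    constructor
    · intro i
      by_cases hi : i = 0
      · have : (⨆ j, ⨆ (_ : j ≠ i), (if j = 0 then (⊤ : Submodule k S) else ⊥)) = ⊥ := by
          simp only [iSup_eq_bot]
          intro j hj
          rw [if_neg (by rwa [hi] at hj)]
        rw [this]
        exact disjoint_bot_right
      · beta_reduce
        rw [if_neg hi]
        exact disjoint_bot_left
    · exact top_unique (le_iSup_of_le 0 (by simp))
  d := 0
  d_mem _ := Submodule.zero_mem _
  d_d _ := rfl
  leibniz _ _ := by simp

variable {k S}

/-- The morphism `p` from the dg algebra `D` to the algebra `S` (placed in degree `0`) exhibits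
`D` as a minimal free resolution of `S` with generators `g x` of degree `deg x`:
`D` is free as a graded algebra on these generators, which have non-positive degrees, `p` is a
quasi-isomorphism, and the differential is decomposable, i.e. it sends each generator to a linear
combination of products of at least two generators. -/
structure IsMinimalFreeResolution (D : DGAlgebra k R) (p : Hom D (ofAlgebra k S))
    {X : Type*} (deg : X → ℤ) (g : X → R) : Prop where
  free : D.IsFreeOn deg g
  nonpos : ∀ x, deg x ≤ 0
  quasiIso : p.IsQuasiIso
  minimal : ∀ x, D.d (g x) ∈
    Submodule.span k {a : R | ∃ l : List X, 2 ≤ l.length ∧ a = (l.map g).prod}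

end Cohomology

section Free

variable {k X : Type*} [Field k] (deg : X → ℤ) (δ : X → FreeAlgebra k X)

/-- The component of degree `i` of the free algebra on generators `x` of degree `deg x`:
the span of the monomials of total degree `i`. -/
def freePiece (i : ℤ) : Submodule k (FreeAlgebra k X) :=
  Submodule.span k {a | ∃ l : List X, (l.map deg).sum = i ∧ a = (l.map (FreeAlgebra.ι k)).prod}

theorem prod_mem_freePiece (l : List X) :
    (l.map (FreeAlgebra.ι k)).prod ∈ freePiece (k := k) deg (l.map deg).sum :=
  Submodule.subset_span ⟨l, rfl, rfl⟩

theorem ι_mem_freePiece (x : X) : FreeAlgebra.ι k x ∈ freePiece (k := k) deg (deg x) := by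
  simpa using prod_mem_freePiece (k := k) deg [x]

instance freePiece_gradedMonoid : SetLike.GradedMonoid (freePiece (k := k) deg) where
  one_mem := by simpa using prod_mem_freePiece (k := k) deg []
  mul_mem {i j a b} ha hb := by
    have h := Submodule.mul_mem_mul ha hb
    rw [freePiece, freePiece, Submodule.span_mul_span] at h
    refine Submodule.span_mono ?_ h
    rintro _ ⟨_, ⟨l, rfl, rfl⟩, _, ⟨m, rfl, rfl⟩, rfl⟩
    exact ⟨l ++ m, by simp, by simp⟩

theorem freePiece_internal : DirectSum.IsInternal (freePiece (k := k) deg) := by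
  let φ : FreeAlgebra k X →ₐ[k] DirectSum ℤ fun i => ↥(freePiece (k := k) deg i) :=
    FreeAlgebra.lift k fun x =>
      DirectSum.of (fun i => ↥(freePiece (k := k) deg i)) (deg x) ⟨_, ι_mem_freePiece deg x⟩
  have key : ∀ l : List X, φ (l.map (FreeAlgebra.ι k)).prod =
      DirectSum.of (fun i => ↥(freePiece (k := k) deg i)) (l.map deg).sum
        ⟨_, prod_mem_freePiece deg l⟩ := by
    intro l
    induction l with
    | nil =>
      simp only [List.map_nil, List.prod_nil, map_one]
      rfl
    | cons x l ih =>
      simp only [List.map_cons, List.prod_cons, map_mul, ih]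
      rw [show φ (FreeAlgebra.ι k x) = _ from FreeAlgebra.lift_ι_apply _ _, DirectSum.of_mul_of]
      exact DirectSum.of_eq_of_gradedMonoid_eq (Sigma.subtype_ext (List.sum_cons (l := l.map deg)).symm rfl)
  let _ : GradedAlgebra (freePiece (k := k) deg) :=
    GradedAlgebra.ofAlgHom _ φ
      (by
        ext x
        simp [φ])
      (by
        rintro i ⟨a, ha⟩
        unfold freePiece at ha
        induction ha using Submodule.span_induction with
        | mem a h =>
          obtain ⟨l, rfl, rfl⟩ := h
          exact key l
        | zero =>
          rw [map_zero]
          exact (map_zero (DirectSum.of (fun i => ↥(freePiece (k := k) deg i)) i)).symm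
        | add a b ha hb iha ihb =>
          rw [map_add, iha, ihb, ← map_add]
          rfl
        | smul c a ha iha =>
          rw [map_smul, iha]
          exact ((DirectSum.lof k ℤ (fun i => ↥(freePiece (k := k) deg i)) i).map_smul c _).symm)
  exact DirectSum.Decomposition.isInternal _

/-- An auxiliary algebra map: its value at `a` is the matrix with rows `(σ a, d a)` and `(0, a)`,
where `σ` is the parity automorphism and `d` the derivation extending `δ`. -/
def freeMatrix : FreeAlgebra k X →ₐ[k] Matrix (Fin 2) (Fin 2) (FreeAlgebra k X) :=
  FreeAlgebra.lift k fun x =>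
    !![((deg x).negOnePow : ℤ) • FreeAlgebra.ι k x, δ x; 0, FreeAlgebra.ι k x]

/-- The linear map on the free algebra which extends `δ` from the generators by the
graded Leibniz rule. -/
def freeD : FreeAlgebra k X →ₗ[k] FreeAlgebra k X where
  toFun a := freeMatrix deg δ a 0 1
  map_add' a b := by simp
  map_smul' c a := by simp

theorem freeD_ι (x : X) : freeD deg δ (FreeAlgebra.ι k x) = δ x := by
  simp [freeD, freeMatrix]

theorem freeMatrix_prod (l : List X) :
    freeMatrix deg δ (l.map (FreeAlgebra.ι k)).prod =
      !![((l.map deg).sum.negOnePow : ℤ) • (l.map (FreeAlgebra.ι k)).prod,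
        freeD deg δ (l.map (FreeAlgebra.ι k)).prod; 0, (l.map (FreeAlgebra.ι k)).prod] := by
  induction l with
  | nil =>
    ext i j
    fin_cases i <;> fin_cases j <;> simp [freeD]
  | cons x l ih =>
    have hx : freeMatrix deg δ (FreeAlgebra.ι k x) = _ := FreeAlgebra.lift_ι_apply _ _
    have h := map_mul (freeMatrix deg δ) (FreeAlgebra.ι k x) (l.map (FreeAlgebra.ι k)).prod
    rw [ih, hx, Matrix.mul_fin_two, ← List.prod_cons, ← List.map_cons] at h
    ext i j
    fin_cases i <;> fin_cases j
    · rw [h]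
      change _ * _ + δ x * 0 = _
      rw [mul_zero, add_zero, smul_mul_smul_comm]
      simp [Int.negOnePow_add]
    · rfl
    · rw [h]
      simp
    · rw [h]
      simp

theorem freeD_leibniz {i : ℤ} {a : FreeAlgebra k X} (ha : a ∈ freePiece deg i)
    (b : FreeAlgebra k X) :
    freeD deg δ (a * b) = freeD deg δ a * b + (i.negOnePow : ℤ) • (a * freeD deg δ b) := by
  have hb : ∀ b : FreeAlgebra k X, freeMatrix deg δ b 1 0 = 0 ∧ freeMatrix deg δ b 1 1 = b := by
    intro b
    induction b using FreeAlgebra.induction with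
    | grade0 r => simp [Matrix.algebraMap_matrix_apply]
    | grade1 x => simp [freeMatrix]
    | mul a b iha ihb => simp [Matrix.mul_apply, Fin.sum_univ_two, iha, ihb]
    | add a b iha ihb => simp [iha, ihb]
  unfold freePiece at ha
  induction ha using Submodule.span_induction with
  | mem a h =>
    obtain ⟨l, rfl, rfl⟩ := h
    change freeMatrix deg δ (_ * b) 0 1 = _
    rw [map_mul, freeMatrix_prod, Matrix.mul_apply, Fin.sum_univ_two, (hb b).2, add_comm]
    simp [freeD, -Int.coe_negOnePow, mul_assoc]
  | zero => simp
  | add a c _ _ iha ihc => rw [add_mul, map_add, iha, ihc, map_add]; simp only [add_mul, smul_add]; abel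
  | smul c a _ iha => simp [iha, smul_comm]

theorem freeD_mem (hδ : ∀ x, δ x ∈ freePiece deg (deg x + 1)) {i : ℤ} {a : FreeAlgebra k X}
    (ha : a ∈ freePiece deg i) : freeD deg δ a ∈ freePiece deg (i + 1) := by
  suffices h : freePiece deg i ≤ (freePiece deg (i + 1)).comap (freeD deg δ) from h ha
  refine Submodule.span_le.2 ?_
  rintro _ ⟨l, rfl, rfl⟩
  change freeD deg δ _ ∈ freePiece deg _
  clear ha
  induction l with
  | nil =>
    have h : freeD deg δ (1 : FreeAlgebra k X) = 0 := by simp [freeD]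
    simp [h]
  | cons x l ih =>
    simp only [List.map_cons, List.prod_cons, List.sum_cons]
    rw [freeD_leibniz deg δ (ι_mem_freePiece deg x), freeD_ι]
    refine Submodule.add_mem _ ?_ (zsmul_mem ?_ _)
    · have h := SetLike.mul_mem_graded (hδ x) (prod_mem_freePiece (k := k) deg l)
      rwa [add_right_comm] at h
    · have h := SetLike.mul_mem_graded (ι_mem_freePiece (k := k) deg x) (ih)
      rwa [← add_assoc] at h

theorem freeD_freeD (hδ : ∀ x, δ x ∈ freePiece deg (deg x + 1))
    (hd : ∀ x, freeD deg δ (δ x) = 0) (a : FreeAlgebra k X) :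
    freeD deg δ (freeD deg δ a) = 0 := by
  have h1 : freeD deg δ (1 : FreeAlgebra k X) = 0 := by simp [freeD]
  have key : ∀ l : List X, freeD deg δ (freeD deg δ (l.map (FreeAlgebra.ι k)).prod) = 0 := by
    intro l
    induction l with
    | nil => simp [h1]
    | cons x l ih =>
      simp only [List.map_cons, List.prod_cons]
      rw [freeD_leibniz deg δ (ι_mem_freePiece deg x), freeD_ι, map_add, map_zsmul,
        freeD_leibniz deg δ (hδ x), freeD_leibniz deg δ (ι_mem_freePiece deg x), freeD_ι, hd, ih,
        Int.negOnePow_succ]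
      simp
  obtain ⟨f, rfl⟩ := (freePiece_internal (k := k) deg).surjective a
  induction f using DirectSum.induction_on with
  | zero => simp
  | add f g hf hg => rw [map_add, map_add, map_add, hf, hg, add_zero]
  | of i f =>
    obtain ⟨a, ha⟩ := f
    rw [DirectSum.coeAddMonoidHom_of]
    suffices h : freePiece deg i ≤ LinearMap.ker (freeD deg δ ∘ₗ freeD deg δ) from h ha
    refine Submodule.span_le.2 ?_
    rintro _ ⟨l, rfl, rfl⟩
    exact key l

/-- The dg algebra which is free as a graded algebra on generators `x` of degree `deg x`, with
the unique differential satisfying `d x = δ x`. -/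
def free (hδ : ∀ x, δ x ∈ freePiece deg (deg x + 1)) (hd : ∀ x, freeD deg δ (δ x) = 0) :
    DGAlgebra k (FreeAlgebra k X) where
  piece := freePiece deg
  one_mem := SetLike.GradedOne.one_mem
  mul_mem ha hb := SetLike.mul_mem_graded ha hb
  internal := freePiece_internal deg
  d := freeD deg δ
  d_mem := freeD_mem deg δ hδ
  d_d := freeD_freeD deg δ hδ hd
  leibniz := freeD_leibniz deg δ

end Free

end DGAlgebra

namespace TripleAlgebra

/-- The relations `[[x_i, x_{i+2}], x_{i+1}] = 0` in the free algebra on `x_0, …, x_{n-1}`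
(indices start at `0`). -/
inductive Rel (k : Type*) [Field k] (n : ℕ) :
    FreeAlgebra k (Fin n) → FreeAlgebra k (Fin n) → Prop
  | triple (i : ℕ) (hi : i + 2 < n) :
    Rel k n ⁅⁅FreeAlgebra.ι k (⟨i, by omega⟩ : Fin n), FreeAlgebra.ι k (⟨i + 2, hi⟩ : Fin n)⁆,
      FreeAlgebra.ι k (⟨i + 1, by omega⟩ : Fin n)⁆ 0

/-- The algebra `A_n = k⟨x_0, …, x_{n-1} | [[x_i, x_{i+2}], x_{i+1}], 0 ≤ i, i + 2 < n⟩`. -/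
abbrev A (k : Type*) [Field k] (n : ℕ) : Type _ := RingQuot (Rel k n)

/-- The generator `x_i` of `A_n`. -/
def A.x (k : Type*) [Field k] {n : ℕ} (i : Fin n) : A k n :=
  RingQuot.mkAlgHom k (Rel k n) (FreeAlgebra.ι k i)

/-- The generators of the resolution: `x i` for each generator of `A_n`, and `u i` for the
triple of indices `i, i + 1, i + 2`. -/
inductive Gen (n : ℕ) : Type
  | x (i : Fin n) : Gen n
  | u (i : ℕ) (hi : i + 2 < n) : Gen n

/-- The degrees of the generators: `x i` has degree `0` and `u i` has degree `-1`. -/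
def Gen.deg {n : ℕ} : Gen n → ℤ
  | .x _ => 0
  | .u _ _ => -1

/-- The generator `x_i` of the resolution. -/
def X (k : Type*) [Field k] {n : ℕ} (i : Fin n) : FreeAlgebra k (Gen n) :=
  FreeAlgebra.ι k (Gen.x i)

/-- The generator `u_{i,i+1,i+2}` of the resolution. -/
def U (k : Type*) [Field k] {n : ℕ} (i : ℕ) (hi : i + 2 < n) : FreeAlgebra k (Gen n) :=
  FreeAlgebra.ι k (Gen.u i hi)

/-- The differential on generators: `d x_i = 0` and
`d u_{i,i+1,i+2} = [[x_i, x_{i+2}], x_{i+1}]`. -/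
def dGen (k : Type*) [Field k] {n : ℕ} : Gen n → FreeAlgebra k (Gen n)
  | .x _ => 0
  | .u i hi => ⁅⁅X k (⟨i, by omega⟩ : Fin n), X k ⟨i + 2, hi⟩⁆, X k ⟨i + 1, by omega⟩⁆

theorem lie_mem (k : Type*) [Field k] {n : ℕ} {a b : FreeAlgebra k (Gen n)}
    (ha : a ∈ DGAlgebra.freePiece Gen.deg 0) (hb : b ∈ DGAlgebra.freePiece Gen.deg 0) :
    ⁅a, b⁆ ∈ DGAlgebra.freePiece (k := k) (Gen.deg (n := n)) 0 := by
  rw [Ring.lie_def]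
  exact Submodule.sub_mem _ (by simpa using SetLike.mul_mem_graded ha hb)
    (by simpa using SetLike.mul_mem_graded hb ha)

theorem dGen_mem (k : Type*) [Field k] {n : ℕ} (y : Gen n) :
    dGen k y ∈ DGAlgebra.freePiece Gen.deg (y.deg + 1) := by
  have hx : ∀ i : Fin n, X k i ∈ DGAlgebra.freePiece Gen.deg 0 :=
    fun i => DGAlgebra.ι_mem_freePiece Gen.deg (Gen.x i)
  cases y with
  | x i => exact Submodule.zero_mem _
  | u i hi => exact lie_mem k (lie_mem k (hx _) (hx _)) (hx _)

theorem d_lie (k : Type*) [Field k] {n : ℕ} {a b : FreeAlgebra k (Gen n)}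
    (ha : a ∈ DGAlgebra.freePiece Gen.deg 0) (hb : b ∈ DGAlgebra.freePiece Gen.deg 0)
    (hda : DGAlgebra.freeD Gen.deg (dGen k) a = 0) (hdb : DGAlgebra.freeD Gen.deg (dGen k) b = 0) :
    DGAlgebra.freeD Gen.deg (dGen k) ⁅a, b⁆ = 0 := by
  rw [Ring.lie_def, map_sub, DGAlgebra.freeD_leibniz _ _ ha, DGAlgebra.freeD_leibniz _ _ hb,
    hda, hdb]
  simp

theorem d_dGen (k : Type*) [Field k] {n : ℕ} (y : Gen n) :
    DGAlgebra.freeD Gen.deg (dGen k) (dGen k y) = 0 := by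
  have hx : ∀ i : Fin n, X k i ∈ DGAlgebra.freePiece Gen.deg 0 :=
    fun i => DGAlgebra.ι_mem_freePiece Gen.deg (Gen.x i)
  have hd : ∀ i : Fin n, DGAlgebra.freeD Gen.deg (dGen k) (X k i) = 0 :=
    fun i => DGAlgebra.freeD_ι Gen.deg (dGen k) (Gen.x i)
  cases y with
  | x i => exact map_zero _
  | u i hi =>
    exact d_lie k (lie_mem k (hx _) (hx _)) (hx _) (d_lie k (hx _) (hx _) (hd _) (hd _)) (hd _)

/-- The dg algebra generated freely by `x_i` of degree `0` and `u_{i,i+1,i+2}` of degree `-1`,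
with `d x_i = 0` and `d u_{i,i+1,i+2} = [[x_i, x_{i+2}], x_{i+1}]`. -/
def resolution (k : Type*) [Field k] (n : ℕ) : DGAlgebra k (FreeAlgebra k (Gen n)) :=
  DGAlgebra.free Gen.deg (dGen k) (dGen_mem k) (d_dGen k)

end TripleAlgebra

/-! Acyclicity in negative degrees follows from a Gröbner-type argument. Order the letters so that
the three letters of each relation `[[x_i, x_{i+2}], x_{i+1}]` are ranked with `x_i` in the middle;
its leading monomial is then the strictly decreasing word, which occurs with coefficient `-1`.
Ranking all even indices above all odd ones makes every leading word begin with an even and end with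
an odd index, and no two leading words overlap, by one letter or by two.

Split `d` as `leadD + tailD`, where `leadD` is the derivation sending `u_i` to minus its leading
word. Absence of overlaps makes `homotopy`, which turns the first leading word back into `-u_i`,
satisfy `leadD h + h leadD = id` on every word containing some `u_i` (`leadD_homotopy_add`), hence
in all negative degrees. With each `u_i` weighted like its leading word, `h` preserves the weight
and `tailD` strictly lowers it. So for a cocycle `a` of negative degree, `a - d (h a) = -(tailD (h
a) + h (tailD a))` is a cohomologous cocycle of lower weight. Weights are natural numbers, so `a` is
a coboundary (`cocycles_le_coboundaries`).

There is nothing in positive degree. In degree `0` the complex is the free algebra on the `x_i`, and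
its coboundaries are the ideal of relations, which gives `H^0 = A_n`. -/

namespace TripleAlgebra

variable {k : Type*} [Field k] {n : ℕ}

/-! ### Words as a basis of the free algebra -/

/-- The monomial of the free algebra which corresponds to a word in the generators. -/
def word (k : Type*) [Field k] {n : ℕ} (l : List (Gen n)) : FreeAlgebra k (Gen n) :=
  (l.map (FreeAlgebra.ι k)).prod

@[simp] theorem word_nil : word k ([] : List (Gen n)) = 1 := rfl

theorem word_cons (g : Gen n) (l : List (Gen n)) :
    word k (g :: l) = FreeAlgebra.ι k g * word k l := by
  simp [word]

theorem word_x_cons (a : Fin n) (l : List (Gen n)) :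
    word k (Gen.x a :: l) = X k a * word k l := word_cons _ _

theorem word_u_cons (i : ℕ) (hi : i + 2 < n) (l : List (Gen n)) :
    word k (Gen.u i hi :: l) = U k i hi * word k l := word_cons _ _

theorem word_append (l m : List (Gen n)) : word k (l ++ m) = word k l * word k m := by
  simp [word]

theorem basisFreeMonoid_eq_word (l : List (Gen n)) :
    FreeAlgebra.basisFreeMonoid k (Gen n) (FreeMonoid.ofList l) = word k l := by
  simp only [FreeAlgebra.basisFreeMonoid, Module.Basis.map_apply, LinearEquiv.symm_trans_apply,
    Finsupp.coe_basisSingleOne, FreeAlgebra.equivMonoidAlgebraFreeMonoid]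
  erw [MonoidAlgebra.lift_single]
  simp [word, FreeMonoid.lift_apply]

theorem span_range_word : Submodule.span k (Set.range (word k (n := n))) = ⊤ := by
  rw [← (FreeAlgebra.basisFreeMonoid k (Gen n)).span_eq]
  congr 1
  ext a
  constructor
  · rintro ⟨l, rfl⟩
    exact ⟨FreeMonoid.ofList l, basisFreeMonoid_eq_word l⟩
  · rintro ⟨l, rfl⟩
    exact ⟨l.toList, (basisFreeMonoid_eq_word _).symm⟩

/-- Two linear maps which agree on all words agree. -/
theorem linearMap_ext_word {M : Type*} [AddCommGroup M] [Module k M]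
    {f g : FreeAlgebra k (Gen n) →ₗ[k] M} (h : ∀ l, f (word k l) = g (word k l)) : f = g :=
  LinearMap.ext_on_range span_range_word h

/-! ### Leading words and the absence of overlaps -/

/-- The first letter of the leading word of `[[x_i, x_{i+2}], x_{i+1}]`. -/
def leadFst (i : ℕ) (hi : i + 2 < n) : Fin n :=
  if Even i then ⟨i + 2, hi⟩ else ⟨i + 1, by omega⟩

/-- The last letter of the leading word of `[[x_i, x_{i+2}], x_{i+1}]`. -/
def leadLast (i : ℕ) (hi : i + 2 < n) : Fin n :=
  if Even i then ⟨i + 1, by omega⟩ else ⟨i + 2, hi⟩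

/-- The leading word of `[[x_i, x_{i+2}], x_{i+1}]`: it starts with a letter of even index and
ends with a letter of odd index. -/
def lead (i : ℕ) (hi : i + 2 < n) : List (Gen n) :=
  [Gen.x (leadFst i hi), Gen.x ⟨i, by omega⟩, Gen.x (leadLast i hi)]

/-- With the odd index of every last letter, this excludes overlaps of one letter. -/
theorem even_leadFst (i : ℕ) (hi : i + 2 < n) : Even (leadFst i hi : ℕ) := by
  unfold leadFst
  split_ifs with h <;> simp only [] <;> grind

theorem not_even_leadLast (i : ℕ) (hi : i + 2 < n) : ¬ Even (leadLast i hi : ℕ) := by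
  unfold leadLast
  split_ifs with h <;> simp only [] <;> grind

/-- Excludes overlaps of two letters: the outer letters of a leading word have larger index than its
middle one, so such an overlap would force `j < i < j`. -/
theorem leadFst_ne_of_leadLast_eq {i j : ℕ} (hi : i + 2 < n) (hj : j + 2 < n)
    (h : (leadLast j hj : ℕ) = i) : (leadFst i hi : ℕ) ≠ j := by
  unfold leadFst
  unfold leadLast at h
  split_ifs at h ⊢ with h1 h2 h2 <;> simp only [] at h ⊢ <;> grind

/-- The middle letter of `lead i` is `x_i`, so it determines `i`. -/
theorem lead_append_inj {i j : ℕ} {hi : i + 2 < n} {hj : j + 2 < n} {r s : List (Gen n)}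
    (h : lead i hi ++ r = lead j hj ++ s) : i = j ∧ r = s := by
  simp only [lead, List.cons_append, List.nil_append, List.cons.injEq, Gen.x.injEq,
    Fin.mk.injEq] at h
  exact ⟨h.2.1, h.2.2.2⟩

/-- A word has a leading word as a prefix. -/
def HasLead (l : List (Gen n)) : Prop :=
  ∃ (i : ℕ) (hi : i + 2 < n) (r : List (Gen n)), l = lead i hi ++ r

/-- Leading words do not overlap: a leading word which is a prefix of `x_a p w_i q` is
a prefix of `x_a p`. -/
theorem HasLead.of_append_lead {a : Fin n} {p q : List (Gen n)} {i : ℕ} {hi : i + 2 < n}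
    (h : HasLead (Gen.x a :: (p ++ lead i hi ++ q))) (s : List (Gen n)) :
    HasLead (Gen.x a :: (p ++ s)) := by
  obtain ⟨j, hj, r, h⟩ := h
  match p with
  | [] =>
    simp only [lead, List.nil_append, List.cons_append, List.cons.injEq, Gen.x.injEq,
      Fin.ext_iff] at h
    exact absurd h.2.1 (leadFst_ne_of_leadLast_eq hi hj h.2.2.1.symm)
  | [y] =>
    simp only [lead, List.nil_append, List.cons_append, List.cons.injEq, Gen.x.injEq] at h
    exact absurd (even_leadFst i hi) (h.2.2.1 ▸ not_even_leadLast j hj)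
  | y :: z :: p =>
    simp only [lead, List.nil_append, List.cons_append, List.cons.injEq, Gen.x.injEq] at h
    refine ⟨j, hj, p ++ s, ?_⟩
    simp [lead, h.1, h.2.1, h.2.2.1]

/-! ### The homotopy -/

open Classical in
/-- The homotopy on words: it replaces the first leading word `w_i` by `-u_i`, and vanishes if
there is none or if some `u_i` comes earlier. -/
noncomputable def homotopyWord (k : Type*) [Field k] {n : ℕ} :
    List (Gen n) → FreeAlgebra k (Gen n)
  | [] => 0
  | Gen.u _ _ :: _ => 0
  | Gen.x a :: l =>
    if h : HasLead (Gen.x a :: l) then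
      -(U k h.choose h.choose_spec.choose * word k h.choose_spec.choose_spec.choose)
    else X k a * homotopyWord k l

/-- The chosen decomposition in `homotopyWord` is the only one, by `lead_append_inj`. -/
theorem homotopyWord_lead (i : ℕ) (hi : i + 2 < n) (r : List (Gen n)) :
    homotopyWord k (lead i hi ++ r) = -(U k i hi * word k r) := by
  have h : HasLead (lead i hi ++ r) := ⟨i, hi, r, rfl⟩
  change HasLead (Gen.x (leadFst i hi) :: ([Gen.x _, Gen.x _] ++ r)) at h
  change homotopyWord k (Gen.x (leadFst i hi) :: ([Gen.x _, Gen.x _] ++ r)) = _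
  rw [homotopyWord, dif_pos h]
  have hs := lead_append_inj (h.choose_spec.choose_spec.choose_spec : lead i hi ++ r = _)
  have hU : ∀ (j : ℕ) (hj : j + 2 < n), i = j → U k j hj = U k i hi := by
    rintro _ _ rfl
    rfl
  exact congrArg Neg.neg
    (congrArg₂ (· * ·) (hU _ _ hs.1) (congrArg (word k) hs.2.symm))

theorem homotopyWord_x_cons {a : Fin n} {l : List (Gen n)} (h : ¬ HasLead (Gen.x a :: l)) :
    homotopyWord k (Gen.x a :: l) = X k a * homotopyWord k l := by
  rw [homotopyWord, dif_neg h]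

/-- The linear extension of `homotopyWord`. -/
noncomputable def homotopy (k : Type*) [Field k] (n : ℕ) :
    FreeAlgebra k (Gen n) →ₗ[k] FreeAlgebra k (Gen n) :=
  (FreeAlgebra.basisFreeMonoid k (Gen n)).constr k fun l => homotopyWord k l.toList

theorem homotopy_word (l : List (Gen n)) : homotopy k n (word k l) = homotopyWord k l := by
  rw [← basisFreeMonoid_eq_word, homotopy, Module.Basis.constr_basis]
  rfl

theorem homotopy_u_mul (i : ℕ) (hi : i + 2 < n) (a : FreeAlgebra k (Gen n)) :
    homotopy k n (U k i hi * a) = 0 := by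
  suffices h : homotopy k n ∘ₗ LinearMap.mulLeft k (U k i hi) = 0 from LinearMap.congr_fun h a
  refine linearMap_ext_word fun l => ?_
  change homotopy k n (U k i hi * word k l) = 0
  rw [← word_u_cons, homotopy_word, homotopyWord]

theorem homotopy_lead_mul (i : ℕ) (hi : i + 2 < n) (a : FreeAlgebra k (Gen n)) :
    homotopy k n (word k (lead i hi) * a) = -(U k i hi * a) := by
  suffices h : homotopy k n ∘ₗ LinearMap.mulLeft k (word k (lead i hi)) =
    -LinearMap.mulLeft k (U k i hi) from LinearMap.congr_fun h a
  refine linearMap_ext_word fun l => ?_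
  change homotopy k n (word k (lead i hi) * word k l) = -(U k i hi * word k l)
  rw [← word_append, homotopy_word, homotopyWord_lead]

theorem freeD_X_mul {δ : Gen n → FreeAlgebra k (Gen n)} {a : Fin n} (hδ : δ (Gen.x a) = 0)
    (b : FreeAlgebra k (Gen n)) :
    DGAlgebra.freeD Gen.deg δ (X k a * b) = X k a * DGAlgebra.freeD Gen.deg δ b := by
  rw [X, DGAlgebra.freeD_leibniz _ _ (DGAlgebra.ι_mem_freePiece Gen.deg (Gen.x a)),
    DGAlgebra.freeD_ι, hδ]
  simp [Gen.deg]

theorem freeD_U_mul (δ : Gen n → FreeAlgebra k (Gen n)) (i : ℕ) (hi : i + 2 < n)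
    (b : FreeAlgebra k (Gen n)) :
    DGAlgebra.freeD Gen.deg δ (U k i hi * b) =
      δ (Gen.u i hi) * b - U k i hi * DGAlgebra.freeD Gen.deg δ b := by
  rw [U, DGAlgebra.freeD_leibniz _ _ (DGAlgebra.ι_mem_freePiece Gen.deg (Gen.u i hi)),
    DGAlgebra.freeD_ι]
  simp [Gen.deg, sub_eq_add_neg]

theorem freeD_one (δ : Gen n → FreeAlgebra k (Gen n)) : DGAlgebra.freeD Gen.deg δ 1 = 0 := by
  simp [DGAlgebra.freeD]

/-! ### The leading differential and its contraction -/

/-- The leading part of the differential on generators. -/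
def leadGen (k : Type*) [Field k] {n : ℕ} : Gen n → FreeAlgebra k (Gen n)
  | .x _ => 0
  | .u i hi => -word k (lead i hi)

/-- The leading part of the differential. -/
def leadD (k : Type*) [Field k] (n : ℕ) : FreeAlgebra k (Gen n) →ₗ[k] FreeAlgebra k (Gen n) :=
  DGAlgebra.freeD Gen.deg (leadGen k)

theorem leadD_X_mul (a : Fin n) (b : FreeAlgebra k (Gen n)) :
    leadD k n (X k a * b) = X k a * leadD k n b :=
  freeD_X_mul rfl b

theorem leadD_U_mul (i : ℕ) (hi : i + 2 < n) (b : FreeAlgebra k (Gen n)) :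
    leadD k n (U k i hi * b) = -(word k (lead i hi) * b) - U k i hi * leadD k n b := by
  rw [← neg_mul]
  exact freeD_U_mul (leadGen k) i hi b

theorem leadD_lead_mul (i : ℕ) (hi : i + 2 < n) (b : FreeAlgebra k (Gen n)) :
    leadD k n (word k (lead i hi) * b) = word k (lead i hi) * leadD k n b := by
  simp [lead, word_x_cons, mul_assoc, leadD_X_mul]

/-- `leadD` of a word is a combination of words in which some `u_i` has been replaced by the
leading word. -/
theorem leadD_word_mem (l : List (Gen n)) : leadD k n (word k l) ∈
    Submodule.span k {a | ∃ (p q : List (Gen n)) (i : ℕ) (hi : i + 2 < n),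
      l = p ++ Gen.u i hi :: q ∧ a = word k (p ++ lead i hi ++ q)} := by
  induction l with
  | nil =>
    rw [word_nil, leadD, freeD_one]
    exact Submodule.zero_mem _
  | cons g l ih =>
    have key : FreeAlgebra.ι k g * leadD k n (word k l) ∈
        Submodule.span k {a | ∃ (p q : List (Gen n)) (i : ℕ) (hi : i + 2 < n),
          g :: l = p ++ Gen.u i hi :: q ∧ a = word k (p ++ lead i hi ++ q)} := by
      generalize leadD k n (word k l) = b at ih
      induction ih using Submodule.span_induction with
      | mem a h =>
        obtain ⟨p, q, i, hi, rfl, rfl⟩ := h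
        rw [← word_cons]
        exact Submodule.subset_span ⟨g :: p, q, i, hi, rfl, rfl⟩
      | zero => simp
      | add a b _ _ iha ihb => rw [mul_add]; exact Submodule.add_mem _ iha ihb
      | smul c a _ iha => rw [mul_smul_comm]; exact Submodule.smul_mem _ _ iha
    cases g with
    | x a => rw [word_x_cons, leadD_X_mul]; exact key
    | u i hi =>
      rw [word_u_cons, leadD_U_mul]
      refine Submodule.sub_mem _ (Submodule.neg_mem _ ?_) key
      rw [← word_append]
      exact Submodule.subset_span ⟨[], l, i, hi, rfl, rfl⟩

/-- `leadD` only inserts leading words at places inside `l`. Without overlaps this creates no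
leading word at the front, so the homotopy still moves past `x_a`. -/
theorem homotopy_X_mul_leadD {a : Fin n} {l : List (Gen n)} (h : ¬ HasLead (Gen.x a :: l)) :
    homotopy k n (X k a * leadD k n (word k l)) =
      X k a * homotopy k n (leadD k n (word k l)) := by
  have hl := leadD_word_mem (k := k) l
  generalize leadD k n (word k l) = b at hl
  induction hl using Submodule.span_induction with
  | mem b hb =>
    obtain ⟨p, q, i, hi, rfl, rfl⟩ := hb
    rw [← word_x_cons, homotopy_word, homotopy_word, homotopyWord_x_cons]
    exact fun h' => h (h'.of_append_lead _)
  | zero => simp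
  | add b c _ _ hb hc => rw [mul_add, map_add, map_add, mul_add, hb, hc]
  | smul r b _ hb => rw [mul_smul_comm, map_smul, map_smul, mul_smul_comm, hb]

/-- `homotopy` contracts `leadD` on the words which contain some `u_i`. -/
theorem leadD_homotopy_add (l : List (Gen n)) (hl : ∃ i hi, Gen.u i hi ∈ l) :
    leadD k n (homotopy k n (word k l)) + homotopy k n (leadD k n (word k l)) = word k l := by
  induction l with
  | nil => simp at hl
  | cons g l ih =>
    cases g with
    | u i hi =>
      -- Only the term where `leadD` expands the first `u_i` survives, and the homotopy turns it
      -- back into `u_i`; the two minus signs cancel.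
      rw [word_u_cons, homotopy_u_mul, leadD_U_mul, map_sub, map_neg, homotopy_u_mul,
        homotopy_lead_mul]
      simp
    | x a =>
      by_cases h : HasLead (Gen.x a :: l)
      · obtain ⟨i, hi, r, hr⟩ := h
        -- The terms `± u_i * leadD r` cancel, leaving the original word.
        rw [hr, word_append, homotopy_lead_mul, map_neg, leadD_U_mul, leadD_lead_mul,
          homotopy_lead_mul]
        abel
      · rw [word_x_cons, leadD_X_mul, homotopy_X_mul_leadD h, ← word_x_cons, homotopy_word,
          homotopyWord_x_cons h, leadD_X_mul, ← homotopy_word, ← mul_add, ih, word_x_cons]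
        simpa using hl

/-! ### Weights of letters and words -/

/-- The rank of the letter `x_i` in an order on the letters for which the words `lead i` are the
largest terms of the relations. -/
def letterRank (i : Fin n) : ℕ := if Even (i : ℕ) then n + i else n - i

/-- Even letters rank above odd ones, the former increasing and the latter decreasing with the
index. Hence, for either parity, `lead i` is strictly decreasing. -/
theorem letterRank_lt_leadFst (i : ℕ) (hi : i + 2 < n) :
    letterRank (⟨i, by omega⟩ : Fin n) < letterRank (leadFst i hi) := by
  unfold letterRank leadFst
  split_ifs <;> simp only [] at * <;> grind

theorem letterRank_leadLast_lt (i : ℕ) (hi : i + 2 < n) :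
    letterRank (leadLast i hi) < letterRank (⟨i, by omega⟩ : Fin n) := by
  unfold letterRank leadLast
  split_ifs <;> simp only [] at * <;> grind

/-- The length of a generator, where `u_i` counts as the word `lead i`. -/
def Gen.size : Gen n → ℕ
  | .x _ => 1
  | .u _ _ => 3

/-- The value of a generator in base `2`, where `u_i` counts as the word `lead i`. -/
def Gen.value : Gen n → ℕ
  | .x i => letterRank i
  | .u i hi => letterRank (leadFst i hi) * 4 + letterRank (⟨i, by omega⟩ : Fin n) * 2 +
      letterRank (leadLast i hi)

/-- The length of a word, where `u_i` counts as the word `lead i`. -/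
def size : List (Gen n) → ℕ
  | [] => 0
  | g :: l => g.size + size l

/-- The value in base `2` of a word with digits `letterRank`, where `u_i` counts as the word
`lead i`. -/
def value : List (Gen n) → ℕ
  | [] => 0
  | g :: l => g.value * 2 ^ size l + value l

/-- The span of the words of the same size as `l` and of smaller value. -/
def lowerSpan (k : Type*) [Field k] {n : ℕ} (l : List (Gen n)) :
    Submodule k (FreeAlgebra k (Gen n)) :=
  Submodule.span k {a | ∃ m : List (Gen n), size m = size l ∧ value m < value l ∧ a = word k m}

/-- Equal size is essential here: it gives the prepended generator the same place value in both
words. -/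
theorem mul_mem_lowerSpan (g : Gen n) {l : List (Gen n)} {a : FreeAlgebra k (Gen n)}
    (ha : a ∈ lowerSpan k l) : FreeAlgebra.ι k g * a ∈ lowerSpan k (g :: l) := by
  unfold lowerSpan at ha
  induction ha using Submodule.span_induction with
  | mem a h =>
    obtain ⟨m, hs, hv, rfl⟩ := h
    rw [← word_cons]
    exact Submodule.subset_span ⟨g :: m, by simp [size, hs], by simp [value, hs, hv], rfl⟩
  | zero => simp
  | add a b _ _ iha ihb => rw [mul_add]; exact Submodule.add_mem _ iha ihb
  | smul c a _ iha => rw [mul_smul_comm]; exact Submodule.smul_mem _ _ iha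

theorem letters_mul_mem_lowerSpan {a b c : Fin n} {i : ℕ} {hi : i + 2 < n} (l : List (Gen n))
    (h : letterRank a * 4 + letterRank b * 2 + letterRank c < (Gen.u i hi).value) :
    X k a * X k b * X k c * word k l ∈ lowerSpan k (Gen.u i hi :: l) := by
  refine Submodule.subset_span ⟨Gen.x a :: Gen.x b :: Gen.x c :: l, ?_, ?_, ?_⟩
  · simp only [size, Gen.size]
    ring
  · have h2 : (letterRank a * 4 + letterRank b * 2 + letterRank c) * 2 ^ size l <
        (Gen.u i hi).value * 2 ^ size l := Nat.mul_lt_mul_of_pos_right h (by positivity)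
    simp only [value, size, Gen.size]
    refine lt_of_eq_of_lt ?_ (Nat.add_lt_add_right h2 _)
    simp only [Gen.value, pow_add]
    ring
  · simp [word_x_cons, mul_assoc]

/-! ### The tail of the differential lowers the weight -/

/-- The differential of the resolution minus its leading part. -/
def tailD (k : Type*) [Field k] (n : ℕ) : FreeAlgebra k (Gen n) →ₗ[k] FreeAlgebra k (Gen n) :=
  (resolution k n).d - leadD k n

theorem resolution_d_X_mul (a : Fin n) (b : FreeAlgebra k (Gen n)) :
    (resolution k n).d (X k a * b) = X k a * (resolution k n).d b :=
  freeD_X_mul rfl b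

theorem resolution_d_U_mul (i : ℕ) (hi : i + 2 < n) (b : FreeAlgebra k (Gen n)) :
    (resolution k n).d (U k i hi * b) =
      dGen k (Gen.u i hi) * b - U k i hi * (resolution k n).d b :=
  freeD_U_mul (dGen k) i hi b

/-- Adding the leading word cancels its coefficient `-1`. The three remaining terms are other
arrangements of the same letters, and `4a + 2b + c` is largest for the decreasing arrangement; this
is why base `2` suffices although the digits may exceed the base. -/
theorem dGen_add_lead_mul_mem (i : ℕ) (hi : i + 2 < n) (l : List (Gen n)) :
    (dGen k (Gen.u i hi) + word k (lead i hi)) * word k l ∈ lowerSpan k (Gen.u i hi :: l) := by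
  have h1 := letterRank_lt_leadFst i hi
  have h2 := letterRank_leadLast_lt i hi
  have hm {a b c : Fin n} := letters_mul_mem_lowerSpan (k := k) (a := a) (b := b) (c := c)
    (hi := hi) l
  by_cases h : Even i
  · have hw : dGen k (Gen.u i hi) + word k (lead i hi) =
        X k ⟨i, by omega⟩ * X k ⟨i + 2, hi⟩ * X k ⟨i + 1, by omega⟩ -
        X k ⟨i + 1, by omega⟩ * X k ⟨i, by omega⟩ * X k ⟨i + 2, hi⟩ +
        X k ⟨i + 1, by omega⟩ * X k ⟨i + 2, hi⟩ * X k ⟨i, by omega⟩ := by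
      simp only [dGen, lead, leadFst, leadLast, if_pos h, word_x_cons, word_nil, Ring.lie_def]
      noncomm_ring
    simp only [leadFst, leadLast, if_pos h] at h1 h2
    rw [hw, add_mul, sub_mul]
    refine Submodule.add_mem _ (Submodule.sub_mem _ (hm ?_) (hm ?_)) (hm ?_) <;>
    · simp only [Gen.value, leadFst, leadLast, if_pos h]
      omega
  · have hw : dGen k (Gen.u i hi) + word k (lead i hi) =
        X k ⟨i, by omega⟩ * X k ⟨i + 2, hi⟩ * X k ⟨i + 1, by omega⟩ -
        X k ⟨i + 2, hi⟩ * X k ⟨i, by omega⟩ * X k ⟨i + 1, by omega⟩ +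
        X k ⟨i + 1, by omega⟩ * X k ⟨i + 2, hi⟩ * X k ⟨i, by omega⟩ := by
      simp only [dGen, lead, leadFst, leadLast, if_neg h, word_x_cons, word_nil, Ring.lie_def]
      noncomm_ring
    simp only [leadFst, leadLast, if_neg h] at h1 h2
    rw [hw, add_mul, sub_mul]
    refine Submodule.add_mem _ (Submodule.sub_mem _ (hm ?_) (hm ?_)) (hm ?_) <;>
    · simp only [Gen.value, leadFst, leadLast, if_neg h]
      omega

/-- Both differentials obey the same signed Leibniz rule, so their difference replaces one `u_i` at
a time by the non-leading terms of its relation. -/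
theorem tailD_word_mem (l : List (Gen n)) : tailD k n (word k l) ∈ lowerSpan k l := by
  induction l with
  | nil =>
    have h : tailD k n 1 = 0 := by
      rw [tailD, LinearMap.sub_apply, leadD, freeD_one, sub_zero]
      exact freeD_one _
    rw [word_nil, h]
    exact Submodule.zero_mem _
  | cons g l ih =>
    have hg := mul_mem_lowerSpan g ih
    cases g with
    | x a =>
      rwa [word_x_cons, tailD, LinearMap.sub_apply, leadD_X_mul, resolution_d_X_mul, ← mul_sub]
    | u i hi =>
      have h : tailD k n (word k (Gen.u i hi :: l)) =
          (dGen k (Gen.u i hi) + word k (lead i hi)) * word k l -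
            U k i hi * tailD k n (word k l) := by
        rw [word_u_cons, tailD, LinearMap.sub_apply, leadD_U_mul, resolution_d_U_mul,
          LinearMap.sub_apply, mul_sub, add_mul]
        abel
      rw [h]
      exact Submodule.sub_mem _ (dGen_add_lead_mul_mem i hi l) hg

/-- Size and value are preserved because `u_i` is counted as `lead i`. -/
theorem homotopy_word_mem (l : List (Gen n)) : homotopy k n (word k l) ∈
    Submodule.span k {a | ∃ m : List (Gen n), size m = size l ∧ value m = value l ∧
      (m.map Gen.deg).sum = (l.map Gen.deg).sum - 1 ∧ a = word k m} := by
  rw [homotopy_word]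
  induction l with
  | nil => exact Submodule.zero_mem _
  | cons g l ih =>
    cases g with
    | u i hi => exact Submodule.zero_mem _
    | x a =>
      by_cases h : HasLead (Gen.x a :: l)
      · obtain ⟨i, hi, r, hr⟩ := h
        rw [hr, homotopyWord_lead, ← word_u_cons]
        refine Submodule.neg_mem _ (Submodule.subset_span ⟨_, ?_, ?_, ?_, rfl⟩)
        · simp only [lead, List.cons_append, List.nil_append, size, Gen.size]
          ring
        · simp only [lead, List.cons_append, List.nil_append, value, size, Gen.size, Gen.value,
            pow_add]
          ring
        · simp [lead, Gen.deg]
          ring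
      · rw [homotopyWord_x_cons h]
        generalize homotopyWord k l = b at ih
        induction ih using Submodule.span_induction with
        | mem b hb =>
          obtain ⟨m, hs, hv, hd, rfl⟩ := hb
          rw [← word_x_cons]
          exact Submodule.subset_span ⟨Gen.x a :: m, by simp [size, hs], by simp [value, hs, hv],
            by simp [hd, Gen.deg], rfl⟩
        | zero => simp
        | add b c _ _ hb hc => rw [mul_add]; exact Submodule.add_mem _ hb hc
        | smul c b _ hb => rw [mul_smul_comm]; exact Submodule.smul_mem _ _ hb

/-! ### Acyclicity in negative degrees -/

/-- The filtration of the free algebra by the values of words. -/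
def valueFiltration (k : Type*) [Field k] (n r : ℕ) : Submodule k (FreeAlgebra k (Gen n)) :=
  Submodule.span k {a | ∃ m : List (Gen n), value m < r ∧ a = word k m}

theorem exists_mem_valueFiltration (a : FreeAlgebra k (Gen n)) :
    ∃ r, a ∈ valueFiltration k n r := by
  have ha : a ∈ Submodule.span k (Set.range (word k (n := n))) := by simp [span_range_word]
  have mono : ∀ {r s : ℕ}, r ≤ s → valueFiltration k n r ≤ valueFiltration k n s := by
    intro r s h
    refine Submodule.span_mono ?_
    rintro _ ⟨m, hm, rfl⟩
    exact ⟨m, hm.trans_le h, rfl⟩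
  induction ha using Submodule.span_induction with
  | mem a h =>
    obtain ⟨l, rfl⟩ := h
    exact ⟨value l + 1, Submodule.subset_span ⟨l, Nat.lt_succ_self _, rfl⟩⟩
  | zero => exact ⟨0, Submodule.zero_mem _⟩
  | add a b _ _ iha ihb =>
    obtain ⟨r, hr⟩ := iha
    obtain ⟨s, hs⟩ := ihb
    exact ⟨max r s, Submodule.add_mem _ (mono (le_max_left _ _) hr) (mono (le_max_right _ _) hs)⟩
  | smul c a _ iha =>
    obtain ⟨r, hr⟩ := iha
    exact ⟨r, Submodule.smul_mem _ _ hr⟩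

theorem tailD_mem_valueFiltration {r : ℕ} {a : FreeAlgebra k (Gen n)}
    (ha : a ∈ valueFiltration k n (r + 1)) : tailD k n a ∈ valueFiltration k n r := by
  suffices h : valueFiltration k n (r + 1) ≤ (valueFiltration k n r).comap (tailD k n) from h ha
  refine Submodule.span_le.2 ?_
  rintro _ ⟨l, hl, rfl⟩
  refine Submodule.span_mono ?_ (tailD_word_mem l)
  rintro _ ⟨m, -, hm, rfl⟩
  exact ⟨m, by omega, rfl⟩

theorem homotopy_mem_valueFiltration {r : ℕ} {a : FreeAlgebra k (Gen n)}
    (ha : a ∈ valueFiltration k n r) : homotopy k n a ∈ valueFiltration k n r := by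
  suffices h : valueFiltration k n r ≤ (valueFiltration k n r).comap (homotopy k n) from h ha
  refine Submodule.span_le.2 ?_
  rintro _ ⟨l, hl, rfl⟩
  refine Submodule.span_mono ?_ (homotopy_word_mem l)
  rintro _ ⟨m, -, hm, -, rfl⟩
  exact ⟨m, by omega, rfl⟩

theorem homotopy_mem_piece {i : ℤ} {a : FreeAlgebra k (Gen n)}
    (ha : a ∈ (resolution k n).piece i) : homotopy k n a ∈ (resolution k n).piece (i - 1) := by
  suffices h : (resolution k n).piece i ≤
    ((resolution k n).piece (i - 1)).comap (homotopy k n) from h ha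
  refine Submodule.span_le.2 ?_
  rintro _ ⟨l, rfl, rfl⟩
  refine Submodule.span_mono ?_ (homotopy_word_mem l)
  rintro _ ⟨m, -, -, hm, rfl⟩
  exact ⟨m, hm, rfl⟩

theorem exists_u_mem_of_deg_neg {l : List (Gen n)} (hl : (l.map Gen.deg).sum < 0) :
    ∃ i hi, Gen.u i hi ∈ l := by
  induction l with
  | nil => simp at hl
  | cons g l ih =>
    cases g with
    | x a => simpa using ih (by simpa [Gen.deg] using hl)
    | u i hi => exact ⟨i, hi, by simp⟩

theorem leadD_homotopy_add_of_mem_piece {i : ℤ} (hi : i < 0) {a : FreeAlgebra k (Gen n)}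
    (ha : a ∈ (resolution k n).piece i) :
    leadD k n (homotopy k n a) + homotopy k n (leadD k n a) = a := by
  suffices h : (resolution k n).piece i ≤ LinearMap.eqLocus
      (leadD k n ∘ₗ homotopy k n + homotopy k n ∘ₗ leadD k n) LinearMap.id from h ha
  refine Submodule.span_le.2 ?_
  rintro _ ⟨l, rfl, rfl⟩
  exact leadD_homotopy_add l (exists_u_mem_of_deg_neg hi)

/-- The resolution is acyclic in negative degrees. -/
theorem cocycles_le_coboundaries {i : ℤ} (hi : i < 0) :
    (resolution k n).cocycles i ≤ (resolution k n).coboundaries i := by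
  intro a ha
  obtain ⟨r, hr⟩ := exists_mem_valueFiltration a
  induction r generalizing a with
  | zero =>
    -- No value is below `0`, so this step of the filtration is zero.
    simp only [valueFiltration, Nat.not_lt_zero, false_and, exists_false, Set.ofPred_false,
      Submodule.span_empty, Submodule.mem_bot] at hr
    rw [hr]
    exact Submodule.zero_mem _
  | succ r ih =>
    have hda : (resolution k n).d a = 0 := ha.2
    have hb := homotopy_mem_piece ha.1
    have hcob : (resolution k n).d (homotopy k n a) ∈ (resolution k n).coboundaries i :=
      Submodule.mem_map_of_mem hb
    -- Since `d a = 0`, `leadD a = -tailD a`; substitute this into the contraction identity.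
    have heq : a - (resolution k n).d (homotopy k n a) =
        -(tailD k n (homotopy k n a) + homotopy k n (tailD k n a)) := by
      have h := leadD_homotopy_add_of_mem_piece hi ha.1
      simp only [tailD, LinearMap.sub_apply, map_sub, hda, map_zero]
      nth_rewrite 1 [← h]
      abel
    rw [← sub_add_cancel a ((resolution k n).d (homotopy k n a))]
    refine Submodule.add_mem _ (ih ⟨?_, ?_⟩ ?_) hcob
    · refine Submodule.sub_mem _ ha.1 ?_
      simpa using (resolution k n).d_mem hb
    · change (resolution k n).d _ = 0
      rw [map_sub, hda, (resolution k n).d_d, sub_zero]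
    · rw [heq]
      exact Submodule.neg_mem _ (Submodule.add_mem _
        (tailD_mem_valueFiltration (homotopy_mem_valueFiltration hr))
        (homotopy_mem_valueFiltration (tailD_mem_valueFiltration hr)))

end TripleAlgebra

/-! ### Coboundaries and vanishing of cohomology -/

namespace DGAlgebra

variable {k R : Type*} [Field k] [Ring R] [Algebra k R]

theorem mul_mem_coboundaries (D : DGAlgebra k R) {i : ℤ} {c b : R} (hc : c ∈ D.cocycles 0)
    (hb : b ∈ D.coboundaries i) : c * b ∈ D.coboundaries i := by
  obtain ⟨a, ha, rfl⟩ := hb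
  have hdc : D.d c = 0 := hc.2
  refine ⟨c * a, by simpa using D.mul_mem hc.1 ha, ?_⟩
  rw [D.leibniz hc.1, hdc]
  simp

theorem mem_coboundaries_mul (D : DGAlgebra k R) {i : ℤ} {c b : R} (hc : c ∈ D.cocycles 0)
    (hb : b ∈ D.coboundaries i) : b * c ∈ D.coboundaries i := by
  obtain ⟨a, ha, rfl⟩ := hb
  have hdc : D.d c = 0 := hc.2
  refine ⟨a * c, by simpa using D.mul_mem ha hc.1, ?_⟩
  rw [D.leibniz ha, hdc]
  simp

theorem subsingleton_cohomology (D : DGAlgebra k R) {i : ℤ}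
    (h : D.cocycles i ≤ D.coboundaries i) : Subsingleton (D.Cohomology i) := by
  exact Submodule.Quotient.subsingleton_iff.2 (Submodule.submoduleOf_eq_top.2 h)

theorem subsingleton_cohomology_ofAlgebra {i : ℤ} (hi : i ≠ 0) :
    Subsingleton ((ofAlgebra k R).Cohomology i) := by
  refine subsingleton_cohomology _ fun a ha => ?_
  have h : a ∈ (if i = 0 then (⊤ : Submodule k R) else ⊥) := ha.1
  rw [if_neg hi, Submodule.mem_bot] at h
  rw [h]
  exact Submodule.zero_mem _

end DGAlgebra

/-! ### The projection onto `A_n` -/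

namespace TripleAlgebra

variable {k : Type*} [Field k] {n : ℕ}

theorem deg_sum_nonpos (l : List (Gen n)) : (l.map Gen.deg).sum ≤ 0 := by
  induction l with
  | nil => simp
  | cons g l ih => cases g <;> simp [Gen.deg] <;> omega

theorem piece_eq_bot_of_pos {i : ℤ} (hi : 0 < i) : (resolution k n).piece i = ⊥ := by
  refine eq_bot_iff.2 (Submodule.span_le.2 ?_)
  rintro _ ⟨l, rfl, rfl⟩
  exact absurd hi (deg_sum_nonpos l).not_gt

theorem d_eq_zero_of_mem_piece_zero {a : FreeAlgebra k (Gen n)}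
    (ha : a ∈ (resolution k n).piece 0) : (resolution k n).d a = 0 := by
  have h := (resolution k n).d_mem ha
  rwa [piece_eq_bot_of_pos (by norm_num), Submodule.mem_bot] at h

theorem subsingleton_cohomology_resolution {i : ℤ} (hi : i ≠ 0) :
    Subsingleton ((resolution k n).Cohomology i) := by
  refine DGAlgebra.subsingleton_cohomology _ ?_
  rcases lt_or_gt_of_ne hi with h | h
  · exact cocycles_le_coboundaries h
  · intro a ha
    have h0 : a ∈ (resolution k n).piece i := ha.1
    rw [piece_eq_bot_of_pos h, Submodule.mem_bot] at h0
    rw [h0]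
    exact Submodule.zero_mem _

/-- The images of the generators of the resolution in `A_n`. -/
def genImage (k : Type*) [Field k] {n : ℕ} : Gen n → A k n
  | .x i => A.x k i
  | .u _ _ => 0

/-- The algebra map from the resolution to `A_n`. -/
def projectionAlgHom (k : Type*) [Field k] (n : ℕ) : FreeAlgebra k (Gen n) →ₐ[k] A k n :=
  FreeAlgebra.lift k (genImage k)

theorem projectionAlgHom_X (i : Fin n) : projectionAlgHom k n (X k i) = A.x k i :=
  FreeAlgebra.lift_ι_apply _ _

theorem projectionAlgHom_U (i : ℕ) (hi : i + 2 < n) : projectionAlgHom k n (U k i hi) = 0 :=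
  FreeAlgebra.lift_ι_apply _ _

theorem projectionAlgHom_word_eq_zero {l : List (Gen n)} (hl : (l.map Gen.deg).sum ≠ 0) :
    projectionAlgHom k n (word k l) = 0 := by
  obtain ⟨i, hi, hu⟩ := exists_u_mem_of_deg_neg (lt_of_le_of_ne (deg_sum_nonpos l) hl)
  obtain ⟨p, q, rfl⟩ := List.append_of_mem hu
  rw [word_append, word_u_cons, map_mul, map_mul, projectionAlgHom_U, zero_mul, mul_zero]

theorem A.lie_lie_x (i : ℕ) (hi : i + 2 < n) :
    ⁅⁅A.x k (⟨i, by omega⟩ : Fin n), A.x k (⟨i + 2, hi⟩ : Fin n)⁆,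
      A.x k (⟨i + 1, by omega⟩ : Fin n)⁆ = 0 := by
  have h := RingQuot.mkAlgHom_rel k (Rel.triple (k := k) i hi)
  simpa only [A.x, Ring.lie_def, map_sub, map_mul, map_zero] using h

theorem projectionAlgHom_dGen (g : Gen n) : projectionAlgHom k n (dGen k g) = 0 := by
  cases g with
  | x i => exact map_zero _
  | u i hi =>
    rw [← A.lie_lie_x (k := k) i hi]
    simp only [dGen, Ring.lie_def, map_sub, map_mul, projectionAlgHom_X]

theorem projectionAlgHom_d (a : FreeAlgebra k (Gen n)) :
    projectionAlgHom k n ((resolution k n).d a) = 0 := by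
  suffices h : (projectionAlgHom k n).toLinearMap ∘ₗ (resolution k n).d = 0 from
    LinearMap.congr_fun h a
  refine linearMap_ext_word fun l => ?_
  change projectionAlgHom k n ((resolution k n).d (word k l)) = 0
  induction l with
  | nil =>
    rw [word_nil, d_eq_zero_of_mem_piece_zero (resolution k n).one_mem, map_zero]
  | cons g l ih =>
    cases g with
    | x a => rw [word_x_cons, resolution_d_X_mul, map_mul, ih, mul_zero]
    | u i hi =>
      rw [word_u_cons, resolution_d_U_mul, map_sub, map_mul, map_mul, ih, projectionAlgHom_dGen,
        zero_mul, mul_zero, sub_zero]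

/-- The morphism of dg algebras from the resolution to `A_n`. -/
def projection (k : Type*) [Field k] (n : ℕ) :
    DGAlgebra.Hom (resolution k n) (DGAlgebra.ofAlgebra k (A k n)) where
  toAlgHom := projectionAlgHom k n
  map_piece {i a} ha := by
    change projectionAlgHom k n a ∈ (if i = 0 then (⊤ : Submodule k (A k n)) else ⊥)
    split_ifs with hi
    · trivial
    · suffices h : (resolution k n).piece i ≤ LinearMap.ker (projectionAlgHom k n).toLinearMap from
        h ha
      refine Submodule.span_le.2 ?_
      rintro _ ⟨l, rfl, rfl⟩
      exact projectionAlgHom_word_eq_zero hi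
  map_d a := projectionAlgHom_d a

/-! ### Cohomology in degree zero -/

/-- The inclusion of the free algebra on the `x_i` in the resolution. -/
def inclusion (k : Type*) [Field k] (n : ℕ) :
    FreeAlgebra k (Fin n) →ₐ[k] FreeAlgebra k (Gen n) :=
  FreeAlgebra.lift k (X k)

theorem inclusion_ι (i : Fin n) : inclusion k n (FreeAlgebra.ι k i) = X k i :=
  FreeAlgebra.lift_ι_apply _ _

theorem projectionAlgHom_inclusion (y : FreeAlgebra k (Fin n)) :
    projectionAlgHom k n (inclusion k n y) = RingQuot.mkAlgHom k (Rel k n) y := by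
  suffices h : (projectionAlgHom k n).comp (inclusion k n) = RingQuot.mkAlgHom k (Rel k n) from
    DFunLike.congr_fun h y
  refine FreeAlgebra.hom_ext (funext fun i => ?_)
  change projectionAlgHom k n (inclusion k n (FreeAlgebra.ι k i)) = _
  rw [inclusion_ι, projectionAlgHom_X]
  rfl

theorem inclusion_mem_piece_zero (y : FreeAlgebra k (Fin n)) :
    inclusion k n y ∈ (resolution k n).piece 0 := by
  induction y using FreeAlgebra.induction with
  | grade0 r =>
    rw [AlgHom.commutes, Algebra.algebraMap_eq_smul_one]
    exact Submodule.smul_mem _ _ (resolution k n).one_mem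
  | grade1 i =>
    rw [inclusion_ι]
    exact DGAlgebra.ι_mem_freePiece Gen.deg (Gen.x i)
  | mul a b ha hb =>
    rw [map_mul]
    simpa using (resolution k n).mul_mem ha hb
  | add a b ha hb =>
    rw [map_add]
    exact Submodule.add_mem _ ha hb

theorem inclusion_mem_cocycles (y : FreeAlgebra k (Fin n)) :
    inclusion k n y ∈ (resolution k n).cocycles 0 :=
  ⟨inclusion_mem_piece_zero y, d_eq_zero_of_mem_piece_zero (inclusion_mem_piece_zero y)⟩

/-- Generators have non-positive degree, so degrees cannot cancel and a word of degree `0` contains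
no `u_i`. -/
theorem exists_inclusion_eq {a : FreeAlgebra k (Gen n)} (ha : a ∈ (resolution k n).piece 0) :
    ∃ y, inclusion k n y = a := by
  suffices h : (resolution k n).piece 0 ≤ LinearMap.range (inclusion k n).toLinearMap from h ha
  refine Submodule.span_le.2 ?_
  rintro _ ⟨l, hl, rfl⟩
  change ∃ y, inclusion k n y = word k l
  clear ha
  induction l with
  | nil => exact ⟨1, map_one _⟩
  | cons g l ih =>
    have hl' := deg_sum_nonpos l
    cases g with
    | x i =>
      obtain ⟨y, hy⟩ := ih (by simpa [Gen.deg] using hl)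
      exact ⟨FreeAlgebra.ι k i * y, by rw [map_mul, inclusion_ι, hy, word_x_cons]⟩
    | u i hi =>
      simp [Gen.deg] at hl
      omega

/-- Each defining relation is `d u_i`, and coboundaries are stable under multiplication by
degree-`0` cocycles on both sides. -/
theorem inclusion_sub_mem_coboundaries_of_rel {y z : FreeAlgebra k (Fin n)}
    (h : RingQuot.Rel (Rel k n) y z) :
    inclusion k n y - inclusion k n z ∈ (resolution k n).coboundaries 0 := by
  induction h with
  | of h =>
    obtain ⟨i, hi⟩ := h
    refine ⟨U k i hi, DGAlgebra.ι_mem_freePiece Gen.deg (Gen.u i hi), ?_⟩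
    simp only [Ring.lie_def, map_sub, map_mul, inclusion_ι, map_zero, sub_zero]
    exact DGAlgebra.freeD_ι Gen.deg (dGen k) (Gen.u i hi)
  | add_left _ ih => simpa using ih
  | mul_left _ ih =>
    rw [map_mul, map_mul, ← sub_mul]
    exact DGAlgebra.mem_coboundaries_mul _ (inclusion_mem_cocycles _) ih
  | mul_right _ ih =>
    rw [map_mul, map_mul, ← mul_sub]
    exact DGAlgebra.mul_mem_coboundaries _ (inclusion_mem_cocycles _) ih

theorem inclusion_sub_mem_coboundaries {y z : FreeAlgebra k (Fin n)}
    (h : RingQuot.mkAlgHom k (Rel k n) y = RingQuot.mkAlgHom k (Rel k n) z) :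
    inclusion k n y - inclusion k n z ∈ (resolution k n).coboundaries 0 := by
  -- `RingQuot` is a `Quot`, so equality of classes means a finite chain of elementary relations.
  have h' : Relation.EqvGen (RingQuot.Rel (Rel k n)) y z := by
    simp only [RingQuot.mkAlgHom_def, RingQuot.mkRingHom_def] at h
    exact Quot.eqvGen_exact (RingQuot.mk.inj h)
  clear h
  induction h' with
  | rel _ _ h => exact inclusion_sub_mem_coboundaries_of_rel h
  | refl => simp
  | symm _ _ _ ih =>
    rw [← neg_sub]
    exact Submodule.neg_mem _ ih
  | trans _ y _ _ _ ih ih' =>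
    rw [← sub_add_sub_cancel _ (inclusion k n y)]
    exact Submodule.add_mem _ ih ih'

theorem mem_coboundaries_of_projection_eq_zero {a : FreeAlgebra k (Gen n)}
    (ha : a ∈ (resolution k n).cocycles 0) (h : projectionAlgHom k n a = 0) :
    a ∈ (resolution k n).coboundaries 0 := by
  obtain ⟨y, rfl⟩ := exists_inclusion_eq ha.1
  rw [projectionAlgHom_inclusion, ← map_zero (RingQuot.mkAlgHom k (Rel k n))] at h
  simpa using inclusion_sub_mem_coboundaries h

theorem exists_cocycle_projection_eq (s : A k n) :
    ∃ z : ↥((resolution k n).cocycles 0), projectionAlgHom k n z = s := by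
  obtain ⟨y, rfl⟩ := RingQuot.mkAlgHom_surjective k (Rel k n) s
  exact ⟨⟨_, inclusion_mem_cocycles y⟩, projectionAlgHom_inclusion y⟩

theorem projection_isQuasiIso : (projection k n).IsQuasiIso := by
  intro i
  by_cases hi : i = 0
  · subst hi
    constructor
    · refine (injective_iff_map_eq_zero _).2 fun c hc => ?_
      obtain ⟨z, rfl⟩ := Submodule.Quotient.mk_surjective _ c
      obtain ⟨b, -, hb⟩ := (Submodule.Quotient.mk_eq_zero _).1 hc
      exact (Submodule.Quotient.mk_eq_zero _).2
        (mem_coboundaries_of_projection_eq_zero z.2 hb.symm)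
    · intro c
      obtain ⟨⟨s, hs⟩, rfl⟩ := Submodule.Quotient.mk_surjective _ c
      obtain ⟨z, rfl⟩ := exists_cocycle_projection_eq s
      exact ⟨Submodule.Quotient.mk z, rfl⟩
  -- Away from degree `0` both cohomologies vanish.
  · have := subsingleton_cohomology_resolution (k := k) (n := n) hi
    have := DGAlgebra.subsingleton_cohomology_ofAlgebra (k := k) (R := A k n) hi
    exact ⟨Function.injective_of_subsingleton _, fun c => ⟨0, Subsingleton.elim _ _⟩⟩

/-! ### Minimality and conclusion -/

theorem dGen_mem_span (g : Gen n) : dGen k g ∈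
    Submodule.span k {a | ∃ l : List (Gen n), 2 ≤ l.length ∧
      a = (l.map (FreeAlgebra.ι k)).prod} := by
  cases g with
  | x i => exact Submodule.zero_mem _
  | u i hi =>
    have h (a b c : Fin n) : X k a * X k b * X k c ∈
        Submodule.span k {a | ∃ l : List (Gen n), 2 ≤ l.length ∧
          a = (l.map (FreeAlgebra.ι k)).prod} :=
      Submodule.subset_span ⟨[Gen.x a, Gen.x b, Gen.x c], by simp, by simp [X, mul_assoc]⟩
    simp only [dGen, Ring.lie_def, sub_mul, mul_sub, ← mul_assoc]
    exact Submodule.sub_mem _ (Submodule.sub_mem _ (h _ _ _) (h _ _ _))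
      (Submodule.sub_mem _ (h _ _ _) (h _ _ _))

theorem projection_isMinimalFreeResolution :
    (resolution k n).IsMinimalFreeResolution (projection k n) Gen.deg (FreeAlgebra.ι k) where
  free :=
    { mem := DGAlgebra.ι_mem_freePiece Gen.deg
      bijective := by
        have h : FreeAlgebra.lift k (FreeAlgebra.ι k (X := Gen n)) = AlgHom.id k _ :=
          FreeAlgebra.hom_ext (funext fun x => FreeAlgebra.lift_ι_apply _ _)
        rw [h]
        exact Function.bijective_id }
  nonpos g := by cases g <;> simp [Gen.deg]
  quasiIso := projection_isQuasiIso
  minimal g := by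
    rw [show (resolution k n).d (FreeAlgebra.ι k g) = dGen k g from DGAlgebra.freeD_ι _ _ _]
    exact dGen_mem_span g

/-- The map from the cohomology of the resolution in degree `0` to `A_n`. -/
def cohomologyZeroMap (k : Type*) [Field k] (n : ℕ) : (resolution k n).Cohomology 0 →ₗ[k] A k n :=
  Submodule.liftQ _ ((projectionAlgHom k n).toLinearMap ∘ₗ Submodule.subtype _) (by
    rintro ⟨_, _⟩ ⟨b, _, rfl⟩
    exact projectionAlgHom_d b)

theorem cohomologyZeroMap_bijective : Function.Bijective (cohomologyZeroMap k n) := by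
  constructor
  · refine (injective_iff_map_eq_zero _).2 fun c hc => ?_
    obtain ⟨z, rfl⟩ := Submodule.Quotient.mk_surjective _ c
    exact (Submodule.Quotient.mk_eq_zero _).2 (mem_coboundaries_of_projection_eq_zero z.2 hc)
  · intro s
    obtain ⟨z, hz⟩ := exists_cocycle_projection_eq s
    exact ⟨Submodule.Quotient.mk z, hz⟩

end TripleAlgebra

theorem corollaryA2 (k : Type*) [Field k] (n : ℕ) :
    (∀ i : Fin n, (TripleAlgebra.resolution k n).d (TripleAlgebra.X k i) = 0) ∧
    (∀ (i : ℕ) (hi : i + 2 < n),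
      (TripleAlgebra.resolution k n).d (TripleAlgebra.U k i hi) =
        ⁅⁅TripleAlgebra.X k (⟨i, by omega⟩ : Fin n), TripleAlgebra.X k (⟨i + 2, hi⟩ : Fin n)⁆,
          TripleAlgebra.X k (⟨i + 1, by omega⟩ : Fin n)⁆) ∧
    ∃ p : DGAlgebra.Hom (TripleAlgebra.resolution k n)
        (DGAlgebra.ofAlgebra k (TripleAlgebra.A k n)),
      (∀ i : Fin n, p.toAlgHom (TripleAlgebra.X k i) = TripleAlgebra.A.x k i) ∧
      (∀ (i : ℕ) (hi : i + 2 < n), p.toAlgHom (TripleAlgebra.U k i hi) = 0) ∧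
      (TripleAlgebra.resolution k n).IsMinimalFreeResolution p
        TripleAlgebra.Gen.deg (FreeAlgebra.ι k) ∧
      (∀ i : ℤ, i ≠ 0 → Subsingleton ((TripleAlgebra.resolution k n).Cohomology i)) ∧
      ∃ e : (TripleAlgebra.resolution k n).Cohomology 0 ≃ₗ[k] TripleAlgebra.A k n,
        ∀ z : ↥((TripleAlgebra.resolution k n).cocycles 0),
          e (Submodule.Quotient.mk z) =
            p.toAlgHom (z : FreeAlgebra k (TripleAlgebra.Gen n)) := by
  open TripleAlgebra in
  exact ⟨fun i => DGAlgebra.freeD_ι Gen.deg (dGen k) (Gen.x i),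
    fun i hi => DGAlgebra.freeD_ι Gen.deg (dGen k) (Gen.u i hi),
    projection k n, projectionAlgHom_X, projectionAlgHom_U, projection_isMinimalFreeResolution,
    fun i hi => subsingleton_cohomology_resolution hi,
    LinearEquiv.ofBijective (cohomologyZeroMap k n) cohomologyZeroMap_bijective, fun z => rfl⟩
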